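/- Let $k$ be a field and let $(Q,\mathcal{P})$ be a thread quiver, that is, a quiver $Q$ (possibly infinite, with loops and multiple arrows allowed) together with a linearly ordered set $\mathcal{P}_\alpha$ (possibly empty) for every arrow $\alpha$ of $Q$. Write $\overline{\mathcal{P}}_\alpha$ for $\mathcal{P}_\alpha$ with the source $s(\alpha)$ adjoined as least element and the target $t(\alpha)$ adjoined as greatest element (these two are kept distinct in $\overline{\mathcal{P}}_\alpha$ even if $\alpha$ is a loop). Let $\mathcal{C}$ be the $k$-linear path category of $(Q,\mathcal{P})$. Its objects are the vertices of $Q$ and the points of the sets $\mathcal{P}_\alpha$. Its morphisms are generated by symbols $\eta_{y,x}\colon x\to y$ for $x\le y$ in some $\overline{\mathcal{P}}_\alpha$, with $\eta_{x,x}=1_x$, $\eta_{z,y}\eta_{y,x}=\eta_{z,x}$ for $x\le y\le z$ in $\overline{\mathcal{P}}_\alpha$, and $\eta_{t(\alpha),s(\alpha)}=\alpha$. Explicitly, $\operatorname{Hom}_{\mathcal{C}}(x,y)$ has as a basis the elements $\eta_{y,s(\beta)}\,p\,\eta_{t(\alpha),x}$ with $p$ a path of $Q$ from $t(\alpha)$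 to $s(\beta)$, for $x\in\mathcal{P}_\alpha$ and $y\in\mathcal{P}_\beta$ (if $x$ or $y$ is a vertex, the corresponding factor is omitted and $p$ starts, respectively ends, at that vertex), together with $\eta_{y,x}$ if $x\le y$ lie in the same $\mathcal{P}_\alpha$. The category $\mathcal{C}$ is called left (respectively right) $Q$-bounded if for every vertex $x$ of $Q$ there are only finitely many vertices $y$ of $Q$ with $\operatorname{Hom}_{\mathcal{C}}(y,x)\neq 0$ (respectively $\operatorname{Hom}_{\mathcal{C}}(x,y)\neq 0$). Let ${\rm rep}^{\rm pwf}\,\mathcal{C}$ be the abelian category of $k$-linear functors from $\mathcal{C}$ to finite-dimensional $k$-vector spaces. Suppose that $\mathcal{C}$ is left or right $Q$-bounded. Then ${\rm rep}^{\rm pwf}\,\mathcal{C}$ is hereditary, that is, $\operatorname{Ext}^n(M,N)=0$ in ${\rm rep}^{\rm pwf}\,\mathcal{C}$ for all objects $M,N$ and all $n\ge 2$. Moreover, every subobject of a projective object of ${\rm rep}^{\rm pwf}\,\mathcal{C}$ is projective. -/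

import Mathlib

open CategoryTheory CategoryTheory.Limits

universe u v w t

/-- A thread quiver: a quiver on the vertex set `V` (possibly infinite, loops and multiple arrows
allowed) together with a linearly ordered set, possibly empty, for every arrow. -/
structure ThreadQuiver (V : Type u) [Quiver.{v} V] where
  /-- the linearly ordered set `P α` put on the arrow `α` -/
  thread : ∀ ⦃a b : V⦄, (a ⟶ b) → Type w
  /-- its linear order -/
  order : ∀ ⦃a b : V⦄ (α : a ⟶ b), LinearOrder (thread α)

namespace ThreadQuiver

variable {V : Type u} [Quiver.{v} V]

instance (T : ThreadQuiver.{u, v, w} V) {a b : V} (α : a ⟶ b) : LinearOrder (T.thread α) :=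
  T.order α

/-- The objects of the path category: the vertices of the quiver and the points of the threads.
(The minimum and the maximum that are added to the thread of `α` are the source and the target
of `α`.) -/
inductive Obj (T : ThreadQuiver.{u, v, w} V) : Type (max u v w)
  | vertex (a : V) : Obj T
  | point {a b : V} (α : a ⟶ b) (x : T.thread α) : Obj T

variable {T : ThreadQuiver.{u, v, w} V}

/-- The first vertex that is met when one leaves an object: the vertex itself, or the target of
the arrow on which the point lies. -/
def Obj.next : T.Obj → V
  | .vertex a => a
  | .point (b := b) _ _ => b

/-- The last vertex that is met before one arrives at an object: the vertex itself, or the source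
of the arrow on which the point lies. -/
def Obj.prev : T.Obj → V
  | .vertex a => a
  | .point (a := a) _ _ => a

/-- The path of the quiver run through when one passes through an object: the trivial path at a
vertex, and the arrow `α` (that is `η_{t(α),x} η_{x,s(α)} = α`) at a point `x` on `α`. -/
def Obj.through : ∀ x : T.Obj, Quiver.Path x.prev x.next
  | .vertex _ => Quiver.Path.nil
  | .point α _ => Quiver.Hom.toPath α

/-- The path-like elements from `x` to `y`, which form the basis of `Hom(x, y)`:
* `η_{y,x}` for points `x ≤ y` on the same arrow;
* `η_{y,s(β)} p η_{t(α),x}` for a path `p` of the quiver from `t(α)` to `s(β)`, where `x` lies on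
  `α` and `y` on `β`; if `x` (or `y`) is a vertex, the factor `η_{t(α),x}` (or `η_{y,s(β)}`) is
  missing, so that between two vertices these are the paths of the quiver. -/
inductive PathLike : T.Obj → T.Obj → Type (max u v w)
  | along {a b : V} {α : a ⟶ b} {x y : T.thread α} (h : x ≤ y) :
      PathLike (Obj.point α x) (Obj.point α y)
  | path {x y : T.Obj} (p : Quiver.Path x.next y.prev) : PathLike x y

/-- The trivial path at an object. -/
def PathLike.id : ∀ x : T.Obj, PathLike x x
  | .vertex _ => .path Quiver.Path.nil
  | .point _ _ => .along le_rfl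

/-- Composition of path-like elements (first `f`, then `g`): concatenation of paths together with
`η_{z,y} η_{y,x} = η_{z,x}`. -/
def PathLike.comp {x y z : T.Obj} : PathLike x y → PathLike y z → PathLike x z
  | .along h, g => match g with
    | .along h' => .along (le_trans h h')
    | .path q => .path q
  | .path p, g => match g with
    | .along _ => .path p
    | .path q => .path ((p.comp y.through).comp q)

/-- The category of path-like elements. -/
instance : Category.{max u v w} T.Obj where
  Hom := PathLike
  id := PathLike.id
  comp := PathLike.comp
  id_comp := by
    rintro (_ | _) _ (_ | p)
    · exact congrArg PathLike.path (Quiver.Path.nil_comp p)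
    · rfl
    · rfl
  comp_id := by
    rintro _ (_ | _) (_ | p)
    · exact congrArg PathLike.path (Quiver.Path.comp_nil p)
    · rfl
    · rfl
  assoc := by
    rintro _ _ _ _ (_ | p) (_ | q) (_ | r)
    case path.path.path =>
      exact congrArg PathLike.path (by simp only [Quiver.Path.comp_assoc])
    all_goals rfl

variable (k : Type t) [Field k] (T)

/-- The `k`-linear path category of a thread quiver: `Hom(x, y)` is the `k`-vector space with
basis the path-like elements from `x` to `y`, with bilinear composition. -/
abbrev PathCategory : Type (max u v w) := Free k T.Obj

variable {T} in
/-- A vertex of the quiver, as an object of the path category. -/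
abbrev vtx (a : V) : T.PathCategory k := Free.of k (Obj.vertex a : T.Obj)

/-- For every vertex `x` there are only finitely many vertices `y` with `Hom(y, x) ≠ 0`. -/
def IsLeftQBounded : Prop :=
  ∀ x : V, {y : V | ∃ f : (vtx k y : T.PathCategory k) ⟶ vtx k x, f ≠ 0}.Finite

/-- For every vertex `x` there are only finitely many vertices `y` with `Hom(x, y) ≠ 0`. -/
def IsRightQBounded : Prop :=
  ∀ x : V, {y : V | ∃ f : (vtx k x : T.PathCategory k) ⟶ vtx k y, f ≠ 0}.Finite

/-- `k`-linear functors from the path category to finite-dimensional vector spaces. -/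
def isLinear : ObjectProperty (T.PathCategory k ⥤ FGModuleCat.{t} k) :=
  fun F => F.Additive ∧ F.Linear k

/-- The category of pointwise finite-dimensional representations: the full subcategory of
`k`-linear functors to finite-dimensional `k`-vector spaces. -/
abbrev RepPwf := (T.isLinear k).FullSubcategory

noncomputable section

/-- Restriction of a representation to the path-like elements. -/
def restrict : T.RepPwf k ⥤ (T.Obj ⥤ FGModuleCat.{t} k) :=
  (T.isLinear k).ι ⋙ (Functor.whiskeringLeft _ _ _).obj (Free.embedding k T.Obj)

/-- The linear extension of a functor defined on the path-like elements. -/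
def extend (F : T.Obj ⥤ FGModuleCat.{t} k) : T.PathCategory k ⥤ FGModuleCat.{t} k where
  obj X := F.obj X
  map {X Y} f := Finsupp.linearCombination k (fun g : PathLike (T := T) X Y => F.map g) f
  map_id X :=
    (Finsupp.linearCombination_single k (1 : k) (𝟙 (show T.Obj from X))).trans
      ((one_smul k _).trans (F.map_id _))
  map_comp {X Y Z} f g := by
    induction f using Finsupp.induction_linear with
    | zero => 
      rw [zero_comp]
      erw [map_zero, zero_comp]
    | add f₁ f₂ h₁ h₂ =>
      rw [Preadditive.add_comp]
      erw [map_add, h₁, h₂, map_add, Preadditive.add_comp]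
    | single f' r =>
      induction g using Finsupp.induction_linear with
      | zero =>
        rw [comp_zero]
        erw [map_zero, comp_zero]
      | add g₁ g₂ h₁ h₂ =>
        rw [Preadditive.comp_add]
        erw [map_add, h₁, h₂, map_add, Preadditive.comp_add]
      | single g' s =>
        erw [Free.single_comp_single, Finsupp.linearCombination_single,
          Finsupp.linearCombination_single, Finsupp.linearCombination_single]
        rw [Linear.smul_comp, Linear.comp_smul, smul_smul]
        erw [F.map_comp]

lemma extend_isLinear (F : T.Obj ⥤ FGModuleCat.{t} k) : T.isLinear k (T.extend k F) :=
  ⟨⟨fun {X Y f g} => map_add (Finsupp.linearCombination k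
      (fun g : PathLike (T := T) X Y => F.map g)) f g⟩,
    ⟨fun {X Y} f r => map_smul (Finsupp.linearCombination k
      (fun g : PathLike (T := T) X Y => F.map g)) r f⟩⟩

instance : (T.restrict k).Additive where

instance : (T.restrict k).Faithful where
  map_injective {F G f g} h := by
    apply ObjectProperty.hom_ext
    apply NatTrans.ext
    funext X
    exact congrFun (congrArg (fun a : (T.restrict k).obj F ⟶ (T.restrict k).obj G => a.app) h) X

instance : (T.restrict k).Full where
  map_surjective {F G} f := by
    have := F.property.1
    have := F.property.2
    have := G.property.1
    have := G.property.2
    let φ : ∀ X : T.PathCategory k, F.obj.obj X ⟶ G.obj.obj X := fun X => f.app X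
    have hφ : ∀ {X Y : T.PathCategory k} (a : X ⟶ Y),
        F.obj.map a ≫ φ Y = φ X ≫ G.obj.map a := fun {X Y} a => by
      refine Finsupp.induction_linear
        (motive := fun a : X ⟶ Y => F.obj.map a ≫ φ Y = φ X ≫ G.obj.map a) a ?_ ?_ ?_
      · have h : F.obj.map (0 : X ⟶ Y) ≫ φ Y = φ X ≫ G.obj.map (0 : X ⟶ Y) := by simp
        exact h
      · intro (a : X ⟶ Y) (b : X ⟶ Y) ha hb
        have h : F.obj.map (a + b) ≫ φ Y = φ X ≫ G.obj.map (a + b) := by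
          simp [Preadditive.add_comp, Preadditive.comp_add, ha, hb]
        exact h
      · intro g r
        let g' : X ⟶ Y := (Free.embedding k T.Obj).map g
        have hg : F.obj.map g' ≫ φ Y = φ X ≫ G.obj.map g' := f.naturality g
        have h : F.obj.map (r • g') ≫ φ Y = φ X ≫ G.obj.map (r • g') := by
          rw [Functor.map_smul, Functor.map_smul, Linear.smul_comp, Linear.comp_smul, hg]
        have e : r • g' = Finsupp.single g r := Finsupp.smul_single_one g r
        rw [e] at h
        exact h
    exact ⟨⟨⟨φ, fun _ _ a => hφ a⟩⟩, rfl⟩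

instance : (T.restrict k).EssSurj where
  mem_essImage F := by
    refine ⟨⟨T.extend k F, T.extend_isLinear k F⟩,
      ⟨NatIso.ofComponents (fun X => Iso.refl (F.obj X)) fun {X Y} f => ?_⟩⟩
    refine (Category.comp_id _).trans (Eq.trans ?_ (Category.id_comp _).symm)
    exact (Finsupp.linearCombination_single k (1 : k) f (v := fun g : PathLike X Y => F.map g)).trans
      (one_smul k _)

instance : (T.restrict k).IsEquivalence where

instance : HasFiniteProducts (T.RepPwf k) :=
  ⟨fun _ => Adjunction.hasLimitsOfShape_of_equivalence (T.restrict k)⟩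

/-- Pointwise finite-dimensional representations form an abelian category (kernels and cokernels
are formed pointwise). -/
instance : Abelian (T.RepPwf k) := abelianOfEquivalence (T.restrict k)

end

end ThreadQuiver

/-- An abelian category is hereditary if `Extⁿ(X, Y) = 0` for all objects `X`, `Y` and all
`n ≥ 2`. -/
def IsHereditary (A : Type u) [Category.{v} A] [Abelian A] : Prop :=
  letI := HasExt.standard A
  ∀ (X Y : A) (n : ℕ), 2 ≤ n → Subsingleton (Abelian.Ext.{max u v} X Y n)

/-! ### Vanishing of higher Ext from lifting of extensions. -/

section ExtLemmas

variable {A : Type u} [Category.{v} A] [Abelian A]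

/-! The whole statement rests on right exactness of `Ext¹(M, -)`, stated as `LiftsExtensions`: an
extension of `M` by `N''` comes from an extension by `N` for every epimorphism `N ⟶ N''`. A class in
`Ext²` is, up to a morphism, a product of the classes of two short exact sequences. Lifting the
first along the epimorphism of the second makes the product contain two consecutive maps of a long
exact sequence, so it vanishes (`ext_eq_zero`). For `L ⊆ P` with `P` projective, `Ext²(P/L, -) = 0`
then forces `Ext¹(L, -) = 0`.

Lifting is proved for functors on the category of path-like elements, to which `restrict` is an
equivalence. An extension of such functors splits pointwise, hence is given by a cocycle obeying the
Leibniz rule, and it is the cocycle that must be lifted. The category is freely glued from the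
closed threads along the vertices, so each thread can be treated separately (`glue`,
`liftsExtensions_functor`). On a finite chain a cocycle is freely determined by its values on
consecutive steps. An arbitrary thread follows by linear compactness, as all Hom spaces are
finite-dimensional (`IsDerivationOn.exists_lift`). -/

open HomologicalComplex in
-- Since `K` vanishes above degree `i`, every element of `K.X i` is a cycle, so `K.X i` maps onto
-- the homology in degree `i`, which `π` identifies with `X`. This term serves as `X'`.
lemma CochainComplex.exists_epi_single_map_eq_comp {X : A} {K : CochainComplex A ℤ} {i : ℤ}
    (π : K ⟶ (single A (ComplexShape.up ℤ) i).obj X) [K.IsStrictlyLE i] [QuasiIsoAt π i] :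
    ∃ (X' : A) (e : X' ⟶ X) (ι : (single A (ComplexShape.up ℤ) i).obj X' ⟶ K),
      Epi e ∧ (single A (ComplexShape.up ℤ) i).map e = ι ≫ π := by
  let c := K.iCyclesIso i (i + 1) (by simp)
    ((K.isZero_of_isStrictlyLE i (i + 1) (by simp)).eq_of_tgt _ _)
  let e := c.inv ≫ K.homologyπ i ≫ homologyMap π i ≫
    (singleObjHomologySelfIso (ComplexShape.up ℤ) i X).hom
  have hπ : π.f i = e ≫ (singleObjXSelf (ComplexShape.up ℤ) i X).inv := by
    rw [← cancel_epi c.hom]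
    dsimp only [e, c]
    rw [Category.assoc, Category.assoc, Category.assoc, Iso.hom_inv_id_assoc, iCyclesIso_hom,
      homologyπ_naturality_assoc, homologyπ_singleObjHomologySelfIso_hom_assoc,
      ← singleObjCyclesSelfIso_inv_iCycles, Iso.hom_inv_id_assoc, ← cyclesMap_i]
  have : Epi e := by
    have := epi_comp (homologyMap π i) (singleObjHomologySelfIso (ComplexShape.up ℤ) i X).hom
    have := epi_comp (K.homologyπ i)
      (homologyMap π i ≫ (singleObjHomologySelfIso (ComplexShape.up ℤ) i X).hom)
    exact epi_comp c.inv _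
  refine ⟨K.X i, e, mkHomFromSingle (𝟙 _) (by
    rintro _ rfl
    apply (K.isZero_of_isStrictlyLE i (i + 1) (by simp)).eq_of_tgt), this, ?_⟩
  apply from_single_hom_ext
  rw [single_map_f_self, comp_f, mkHomFromSingle_f, hπ]
  simp

/-- A morphism of positive degree in the derived category between objects of `A` becomes zero
after the composition with a suitable epimorphism of `A`. -/
lemma DerivedCategory.exists_epi_singleFunctor_map_comp_eq_zero [HasDerivedCategory.{w} A] {X : A}
    {L : CochainComplex A ℤ} {i : ℤ}
    (φ : Q.obj ((CochainComplex.singleFunctor A i).obj X) ⟶ Q.obj L)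
    (n : ℤ) (hn : n < i) [L.IsStrictlyLE n] :
    ∃ (X' : A) (e : X' ⟶ X), Epi e ∧ Q.map ((CochainComplex.singleFunctor A i).map e) ≫ φ = 0 := by
  -- A roof `X ⟵ K ⟶ L` with `K` zero above degree `i`. After pullback to `X' = K.X i` it becomes an
  -- actual chain map out of degree `i`, where `L` is zero.
  obtain ⟨K, _, π, h, g, rfl⟩ := right_fac_of_isStrictlyLE φ i
  let π' : K ⟶ (HomologicalComplex.single A (ComplexShape.up ℤ) i).obj X := π
  have : QuasiIso π' := by rwa [isIso_Q_map_iff_quasiIso] at h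
  obtain ⟨X', e, ι, h₁, h₂⟩ := CochainComplex.exists_epi_single_map_eq_comp π'
  have h₃ : ι ≫ g = 0 := by
    apply HomologicalComplex.from_single_hom_ext
    apply (L.isZero_of_isStrictlyLE n i hn).eq_of_tgt
  refine ⟨X', e, h₁, ?_⟩
  have h₄ : (CochainComplex.singleFunctor A i).map e = ι ≫ π := h₂
  have h₅ : Q.map (ι ≫ π) = Q.map ι ≫ Q.map π := Q.map_comp ι π
  rw [h₄]
  refine (congrArg (· ≫ inv (Q.map π) ≫ Q.map g) h₅).trans ?_
  rw [Category.assoc, IsIso.hom_inv_id_assoc, ← Q.map_comp, h₃, Q.map_zero]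
  rfl

namespace CategoryTheory.Abelian.Ext

variable [HasExt.{w} A]

open _root_.DerivedCategory CategoryTheory.DerivedCategory in
-- Effaceability: the class is a derived morphism from `X` in degree `0` to `Y` in degree `-(n +
-- 1)`, which is strictly below `0`.
lemma exists_epi_comp_eq_zero {X Y : A} {n : ℕ} (x : Ext X Y (n + 1)) :
    ∃ (X' : A) (e : X' ⟶ X), Epi e ∧ (mk₀ e).comp x (zero_add _) = 0 := by
  let := HasDerivedCategory.standard A
  obtain ⟨X', e, he, h⟩ := exists_epi_singleFunctor_map_comp_eq_zero
    (L := (CochainComplex.singleFunctor A (-(n + 1))).obj Y) (i := 0) (X := X)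
    (x.hom ≫ ((singleFunctors A).shiftIso (n + 1) (-(n + 1)) 0 (by lia)).hom.app _)
    (-(n + 1)) (by lia)
  refine ⟨X', e, he, ?_⟩
  apply homEquiv.injective
  rw [← cancel_mono (((singleFunctors A).shiftIso (n + 1) (-(n + 1)) 0 (by lia)).hom.app _)]
  have h₁ : ((mk₀ e).comp x (zero_add _)).hom = (singleFunctor A 0).map e ≫ x.hom := by
    simp only [comp_hom, mk₀_hom, ShiftedHom.mk₀_comp]
  have h₂ : (0 : Ext X' Y (n + 1)).hom = 0 := zero_hom _ _ _
  refine (congrArg (· ≫ _) h₁).trans ((Category.assoc _ _ _).trans ?_)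
  refine Eq.trans ?_ (congrArg (· ≫ _) h₂).symm
  rw [Limits.zero_comp]
  exact h

/-- Dimension shift: once an epimorphism onto `X` kills the class, the long exact sequence of its
kernel puts the class in the image of the connecting map. -/
lemma exists_eq_extClass_comp {X Y : A} {n : ℕ} (x : Ext X Y (n + 1)) :
    ∃ (R P : A) (i : R ⟶ P) (e : P ⟶ X) (w : i ≫ e = 0)
      (hS : (ShortComplex.mk i e w).ShortExact) (y : Ext R Y n),
      x = hS.extClass.comp y (add_comm 1 n) := by
  obtain ⟨P, e, he, h⟩ := x.exists_epi_comp_eq_zero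
  have hS : (ShortComplex.mk _ _ (kernel.condition e)).ShortExact :=
    { exact := ShortComplex.exact_of_f_is_kernel _ (kernelIsKernel e)
      epi_g := he }
  obtain ⟨y, hy⟩ := contravariant_sequence_exact₃ hS Y x h (add_comm 1 n)
  exact ⟨_, P, _, e, _, hS, y, hy.symm⟩

end CategoryTheory.Abelian.Ext

/-- An abelian category in which extensions lift along epimorphisms of their kernels: a short exact
sequence `0 ⟶ N'' ⟶ E'' ⟶ M ⟶ 0` is the pushout of one with kernel `N` along any given
epimorphism `N ⟶ N''`. -/
def CategoryTheory.LiftsExtensions (A : Type u) [Category.{v} A] [Abelian A] : Prop :=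
  ∀ (S : ShortComplex A) (_ : S.ShortExact) (N : A) (p : N ⟶ S.X₁) (_ : Epi p),
    ∃ (E : A) (j : N ⟶ E) (q : E ⟶ S.X₂) (w : j ≫ q ≫ S.g = 0),
      (ShortComplex.mk j (q ≫ S.g) w).ShortExact ∧ j ≫ q = p ≫ S.f

namespace CategoryTheory.LiftsExtensions

open Abelian

/-- The lifted extension `E` has class `δ` with `δ · p` equal to the class of `S`, and `p` times the
class of the second sequence is zero. -/
lemma extClass_comp_extClass [HasExt.{w} A] (h : LiftsExtensions A) {S : ShortComplex A}
    (hS : S.ShortExact) {K N : A} {i : K ⟶ N} {p : N ⟶ S.X₁} {w : i ≫ p = 0}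
    (hT : (ShortComplex.mk i p w).ShortExact) :
    hS.extClass.comp hT.extClass (rfl : 1 + 1 = 2) = 0 := by
  obtain ⟨E, j, q, w', hE, hq⟩ := h S hS N p hT.epi_g
  let φ : ShortComplex.mk j (q ≫ S.g) w' ⟶ S :=
    { τ₁ := p
      τ₂ := q
      τ₃ := 𝟙 _
      comm₁₂ := hq.symm }
  have h₁ := ShortComplex.ShortExact.extClass_naturality hE hS φ
  rw [Ext.mk₀_id_comp] at h₁
  have h₂ : (Ext.mk₀ p).comp hT.extClass (zero_add 1) = 0 := hT.comp_extClass
  rw [← h₁, Ext.comp_assoc_of_second_deg_zero, h₂, Ext.comp_zero]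

theorem ext_eq_zero [HasExt.{w} A] (h : LiftsExtensions A) {X Y : A} (n : ℕ)
    (x : Ext X Y (n + 2)) : x = 0 := by
  induction n generalizing X Y with
  | zero =>
    obtain ⟨R, P, i, e, w, hS, y, rfl⟩ := x.exists_eq_extClass_comp
    obtain ⟨R', P', i', e', w', hS', z, rfl⟩ := y.exists_eq_extClass_comp
    rw [← Ext.comp_assoc (a₁₂ := 2) _ _ _ rfl (add_comm 1 0) rfl]
    erw [h.extClass_comp_extClass hS hS']
    rw [Ext.zero_comp]
  | succ n ih =>
    obtain ⟨R, P, i, e, w, hS, y, rfl⟩ := x.exists_eq_extClass_comp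
    rw [ih y, Ext.comp_zero]

theorem isHereditary (h : LiftsExtensions A) : IsHereditary A := by
  let := HasExt.standard A
  intro X Y n hn
  obtain ⟨n, rfl⟩ := Nat.exists_eq_add_of_le' hn
  exact subsingleton_of_forall_eq 0 (h.ext_eq_zero n)

/-- The cokernel of `i` has projective dimension at most one, so the kernel of a projective cover
map onto it is projective; no minimality of that map is involved. -/
theorem projective_of_mono (h : LiftsExtensions A) {L P : A} (i : L ⟶ P) [Mono i] [Projective P] :
    Projective L := by
  let := HasExt.standard A
  let S := ShortComplex.mk _ _ (cokernel.condition i)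
  have hS : S.ShortExact :=
    { exact := ShortComplex.exact_of_g_is_cokernel _ (cokernelIsCokernel S.f)
      mono_f := ‹_› }
  have h₃ : HasProjectiveDimensionLT S.X₃ 2 := .mk fun n hn Y e => by
    obtain ⟨n, rfl⟩ := Nat.exists_eq_add_of_le' hn
    exact h.ext_eq_zero n e
  have h₂ : HasProjectiveDimensionLT S.X₂ 1 :=
    projective_iff_hasProjectiveDimensionLT_one.1 ‹Projective P›
  exact projective_iff_hasProjectiveDimensionLT_one.2 (hS.hasProjectiveDimensionLT_X₁ 1 h₂ h₃)

end CategoryTheory.LiftsExtensions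

end ExtLemmas

/-! ### Linear compactness of finite-dimensional unknowns. -/

section LinearCompactness

variable {k : Type*} [Field k] {I : Type*} (X : I → Type*) [∀ i, AddCommGroup (X i)]
  [∀ i, Module k (X i)]

/-- The linear functionals on a product of vector spaces that depend on finitely many
coordinates. -/
def finitaryDual : Submodule k (Module.Dual k (∀ i, X i)) :=
  ⨆ i, LinearMap.range (LinearMap.proj (R := k) (φ := X) i).dualMap

variable {X}

lemma comp_proj_mem_finitaryDual (i : I) (f : Module.Dual k (X i)) :
    f ∘ₗ LinearMap.proj (φ := X) i ∈ finitaryDual (k := k) X :=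
  Submodule.mem_iSup_of_mem i ⟨f, rfl⟩

/-- On a product of finite-dimensional vector spaces, every linear form on the dual space is given
on the finitary functionals by the evaluation at a point. -/
lemma exists_forall_finitaryDual_apply_eq [∀ i, FiniteDimensional k (X i)]
    (v : Module.Dual k (Module.Dual k (∀ i, X i))) :
    ∃ x : ∀ i, X i, ∀ f ∈ finitaryDual (k := k) X, v f = f x := by
  -- Restricted to the `i`-th coordinate, `v` lies in the bidual of `X i`, which is `X i` itself by
  -- finite dimension.
  refine ⟨fun i => (Module.evalEquiv k (X i)).symm
    (v ∘ₗ (LinearMap.proj (R := k) (φ := X) i).dualMap), fun f hf => ?_⟩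
  induction hf using Submodule.iSup_induction' with
  | mem i f hf =>
    obtain ⟨f, rfl⟩ := hf
    simp
  | zero => simp
  | add f g _ _ hf hg => simp [hf, hg]

/-- A system of linear equations in finite-dimensional unknowns, each of which involves finitely
many unknowns, is solvable if all its finite subsystems are. -/
theorem exists_solution_of_finite_solvable [∀ i, FiniteDimensional k (X i)] {J : Type*}
    {Y : J → Type*} [∀ j, AddCommGroup (Y j)] [∀ j, Module k (Y j)]
    (Φ : ∀ j, (∀ i, X i) →ₗ[k] Y j) (b : ∀ j, Y j)
    (hΦ : ∀ j (g : Module.Dual k (Y j)), g ∘ₗ Φ j ∈ finitaryDual (k := k) X)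
    (h : ∀ s : Finset J, ∃ x, ∀ j ∈ s, Φ j x = b j) :
    ∃ x, ∀ j, Φ j x = b j := by
  classical
  let α : ((Σ j, Module.Dual k (Y j)) →₀ k) →ₗ[k] Module.Dual k (∀ i, X i) :=
    Finsupp.linearCombination k fun e => e.2 ∘ₗ Φ e.1
  let β : ((Σ j, Module.Dual k (Y j)) →₀ k) →ₗ[k] k :=
    Finsupp.linearCombination k fun e => e.2 (b e.1)
  -- A solution in the bidual exists if each relation among the left-hand sides (`α`) also holds
  -- among the right-hand sides (`β`). A relation involves finitely many equations, so a solution of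
  -- those verifies it.
  have hβ : β ∈ LinearMap.range α.dualMap := by
    rw [LinearMap.range_dualMap_eq_dualAnnihilator_ker, Submodule.mem_dualAnnihilator]
    intro c hc
    obtain ⟨x, hx⟩ := h (c.support.image Sigma.fst)
    have : α c x = β c := by
      simp only [α, β, Finsupp.linearCombination_apply, Finsupp.sum, LinearMap.sum_apply]
      refine Finset.sum_congr rfl fun e he => ?_
      simp [hx e.1 (Finset.mem_image_of_mem _ he)]
    rw [← this, hc, LinearMap.zero_apply]
  obtain ⟨v, hv⟩ := hβ
  obtain ⟨x, hx⟩ := exists_forall_finitaryDual_apply_eq v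
  refine ⟨x, fun j => ?_⟩
  rw [← sub_eq_zero, ← Module.forall_dual_apply_eq_zero_iff k]
  intro g
  have := LinearMap.congr_fun hv (Finsupp.single ⟨j, g⟩ 1)
  simp only [α, β, LinearMap.dualMap_apply, Finsupp.linearCombination_single, one_smul] at this
  rw [map_sub, ← this, hx _ (hΦ j g), LinearMap.comp_apply, sub_self]

end LinearCompactness

/-! ### Lifting derivations on a linear order. -/

section DerivationLift

variable {A : Type u} [Category.{v} A] [Preadditive A] {L : Type w}

/-- A family of morphisms `c : M x ⟶ N y`, indexed by the pairs `x ≤ y` of points of `s`, which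
satisfies the Leibniz rule. -/
def IsDerivationOn [Preorder L] (s : Set L) {M N : L ⥤ A}
    (c : ∀ ⦃x y : L⦄, x ≤ y → (M.obj x ⟶ N.obj y)) : Prop :=
  ∀ ⦃x y z : L⦄ (h : x ≤ y) (h' : y ≤ z), x ∈ s → y ∈ s → z ∈ s →
    c (h.trans h') = c h ≫ N.map (homOfLE h') + M.map (homOfLE h) ≫ c h'

lemma IsDerivationOn.map_refl [Preorder L] {s : Set L} {M N : L ⥤ A}
    {c : ∀ ⦃x y : L⦄, x ≤ y → (M.obj x ⟶ N.obj y)} (hc : IsDerivationOn s c) {x : L} (hx : x ∈ s) :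
    c (le_refl x) = 0 := by
  simpa using hc le_rfl le_rfl hx hx hx

variable [LinearOrder L] {M N N' : L ⥤ A} (p : N ⟶ N') [∀ x, IsSplitEpi (p.app x)]
  {c' : ∀ ⦃x y : L⦄, x ≤ y → (M.obj x ⟶ N'.obj y)}

/-- When a new maximum `m` is added, only the step from the old maximum to `m` is free. Its value is
lifted by a section of `p`, and the Leibniz rule forces the rest. -/
lemma IsDerivationOn.exists_lift_finset (hc' : IsDerivationOn Set.univ c') (s : Finset L) :
    ∃ c : ∀ ⦃x y : L⦄, x ≤ y → (M.obj x ⟶ N.obj y), IsDerivationOn (s : Set L) c ∧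
      ∀ ⦃x y : L⦄ (h : x ≤ y), x ∈ s → y ∈ s → c h ≫ p.app y = c' h := by
  induction s using Finset.induction_on_max with
  | empty => exact ⟨fun _ _ _ => 0, by simp [IsDerivationOn], by simp⟩
  | insert m s hm ih =>
    obtain ⟨c, hc, hcp⟩ := ih
    have hms : m ∉ s := fun h => lt_irrefl _ (hm m h)
    have key : ∃ d : ∀ ⦃x : L⦄, x ≤ m → (M.obj x ⟶ N.obj m),
        d le_rfl = 0 ∧ (∀ ⦃x y : L⦄ (h : x ≤ y) (h' : y ≤ m), x ∈ s → y ∈ s →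
          d (h.trans h') = c h ≫ N.map (homOfLE h') + M.map (homOfLE h) ≫ d h') ∧
        ∀ ⦃x : L⦄ (h : x ≤ m), x ∈ s → d h ≫ p.app m = c' h := by
      obtain rfl | hs := s.eq_empty_or_nonempty
      · exact ⟨fun _ _ => 0, rfl, by simp, by simp⟩
      · let m' := s.max' hs
        have hm' : m' < m := hm _ (s.max'_mem hs)
        -- The default `0` is used at `x = m`, where a derivation must vanish; every point of `s`
        -- lies below `m'`.
        refine ⟨fun x h => if h' : x ≤ m' then c h' ≫ N.map (homOfLE hm'.le) +
          M.map (homOfLE h') ≫ c' hm'.le ≫ section_ (p.app m) else 0,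
          dif_neg hm'.not_ge, fun x y h h' hx hy => ?_, fun x h hx => ?_⟩
        · have hy' : y ≤ m' := s.le_max' y hy
          beta_reduce
          rw [dif_pos (h.trans hy'), dif_pos hy', hc h hy' hx hy (s.max'_mem hs)]
          simp only [Preadditive.add_comp, Preadditive.comp_add, Category.assoc,
            ← Functor.map_comp, ← Functor.map_comp_assoc, homOfLE_comp, add_assoc]
        · have hx' : x ≤ m' := s.le_max' x hx
          beta_reduce
          rw [dif_pos hx', hc' hx' hm'.le trivial trivial trivial]
          simp [Preadditive.add_comp, ← hcp hx' hx (s.max'_mem hs)]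
    obtain ⟨d, hd₀, hd, hdp⟩ := key
    -- The factor `N.map` is an identity that only transports along `y = m`.
    let C : ∀ ⦃x y : L⦄, x ≤ y → (M.obj x ⟶ N.obj y) := fun x y h =>
      if hy : y = m then d (h.trans hy.le) ≫ N.map (homOfLE hy.ge) else c h
    have hC₁ : ∀ ⦃x : L⦄ (h : x ≤ m), C h = d h := fun x h =>
      (dif_pos rfl).trans ((congrArg _ (N.map_id m)).trans (Category.comp_id _))
    have hC₂ : ∀ ⦃x y : L⦄ (h : x ≤ y), y ∈ s → C h = c h := fun x y h hy =>
      dif_neg (ne_of_mem_of_not_mem hy hms)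
    have hs : ∀ ⦃x y : L⦄, x ≤ y → x ∈ insert m s → y ∈ s → x ∈ s := fun x y h hx hy =>
      (Finset.mem_insert.1 hx).resolve_left fun e => (hm y hy).not_ge (e ▸ h)
    refine ⟨C, ?_, ?_⟩
    · intro x y z h h' hx hy hz
      obtain rfl | hz := Finset.mem_insert.1 hz
      · obtain rfl | hy := Finset.mem_insert.1 hy
        · rw [hC₁, hC₁, hd₀, comp_zero, add_zero]
          exact ((congrArg _ (N.map_id _)).trans (Category.comp_id _)).symm
        · rw [hC₁, hC₁, hC₂ _ hy]
          exact hd h h' (hs h hx hy) hy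
      · have hy' := hs h' hy hz
        rw [hC₂ _ hz, hC₂ _ hz, hC₂ _ hy']
        exact hc h h' (hs h hx hy') hy' hz
    · intro x y h hx hy
      obtain rfl | hy := Finset.mem_insert.1 hy
      · obtain rfl | hx := Finset.mem_insert.1 hx
        · rw [hC₁, hd₀, zero_comp, hc'.map_refl trivial]
        · rw [hC₁, hdp h hx]
      · rw [hC₂ _ hy, hcp h (hs h hx hy) hy]

/-- Derivations on a linear order lift along pointwise split epimorphisms, if the morphisms form
finite-dimensional vector spaces. -/
theorem IsDerivationOn.exists_lift (k : Type t) [Field k] [Linear k A]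
    [∀ X Y : A, FiniteDimensional k (X ⟶ Y)] (hc' : IsDerivationOn Set.univ c') :
    ∃ c : ∀ ⦃x y : L⦄, x ≤ y → (M.obj x ⟶ N.obj y), IsDerivationOn Set.univ c ∧
      ∀ ⦃x y : L⦄ (h : x ≤ y), c h ≫ p.app y = c' h := by
  classical
  -- The unknowns are the values on pairs `x ≤ y`. Each triple `x ≤ y ≤ z` imposes the Leibniz rule
  -- and the lifting condition on `x ≤ z`, and so involves only three unknowns.
  let I := {q : L × L // q.1 ≤ q.2}
  let J := {q : L × L × L // q.1 ≤ q.2.1 ∧ q.2.1 ≤ q.2.2}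
  let X (i : I) := M.obj i.1.1 ⟶ N.obj i.1.2
  let π {x y : L} (h : x ≤ y) : (∀ i, X i) →ₗ[k] (M.obj x ⟶ N.obj y) :=
    LinearMap.proj (φ := X) ⟨(x, y), h⟩
  let Φ (j : J) : (∀ i, X i) →ₗ[k]
      (M.obj j.1.1 ⟶ N.obj j.1.2.2) × (M.obj j.1.1 ⟶ N'.obj j.1.2.2) :=
    LinearMap.prod
      (π (j.2.1.trans j.2.2) - Linear.rightComp k _ (N.map (homOfLE j.2.2)) ∘ₗ π j.2.1
        - Linear.leftComp k _ (M.map (homOfLE j.2.1)) ∘ₗ π j.2.2)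
      (Linear.rightComp k _ (p.app j.1.2.2) ∘ₗ π (j.2.1.trans j.2.2))
  have hΦ (j : J) (g : Module.Dual k _) : g ∘ₗ Φ j ∈ finitaryDual (k := k) X := by
    let W := finitaryDual (k := k) X
    have hW {x y : L} (h : x ≤ y) (f : Module.Dual k (M.obj x ⟶ N.obj y)) : f ∘ₗ π h ∈ W :=
      comp_proj_mem_finitaryDual (X := X) ⟨(x, y), h⟩ f
    let g₁ := g ∘ₗ LinearMap.inl k _ _
    let g₂ := g ∘ₗ LinearMap.inr k _ _
    have : _ ∈ W := W.add_mem (W.sub_mem (W.sub_mem (hW (j.2.1.trans j.2.2) g₁)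
      (hW j.2.1 (g₁ ∘ₗ Linear.rightComp k _ (N.map (homOfLE j.2.2)))))
      (hW j.2.2 (g₁ ∘ₗ Linear.leftComp k _ (M.map (homOfLE j.2.1)))))
      (hW (j.2.1.trans j.2.2) (g₂ ∘ₗ Linear.rightComp k _ (p.app j.1.2.2)))
    convert this using 1
    refine LinearMap.ext fun x => ?_
    have hx : Φ j x = LinearMap.inl k _ _ (Φ j x).1 + LinearMap.inr k _ _ (Φ j x).2 := by simp
    have h₁ : (Φ j x).1 = π (j.2.1.trans j.2.2) x -
        Linear.rightComp k _ (N.map (homOfLE j.2.2)) (π j.2.1 x) -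
        Linear.leftComp k _ (M.map (homOfLE j.2.1)) (π j.2.2 x) := rfl
    rw [LinearMap.comp_apply, hx, map_add, h₁, map_sub, map_sub, map_sub, map_sub]
    rfl
  have hfin (s : Finset J) : ∃ x, ∀ j ∈ s, Φ j x = (0, c' (j.2.1.trans j.2.2)) := by
    obtain ⟨c, hc, hcp⟩ := hc'.exists_lift_finset p
      (s.biUnion fun j => {j.1.1, j.1.2.1, j.1.2.2})
    refine ⟨fun i => c i.2, fun j hj => ?_⟩
    have h {x : L} (hx : x = j.1.1 ∨ x = j.1.2.1 ∨ x = j.1.2.2) :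
        x ∈ s.biUnion fun j => {j.1.1, j.1.2.1, j.1.2.2} :=
      Finset.mem_biUnion.2 ⟨j, hj, by simpa using hx⟩
    refine Prod.ext ?_ (hcp _ (h (by simp)) (h (by simp)))
    have := hc j.2.1 j.2.2 (h (by simp)) (h (by simp)) (h (by simp))
    exact (sub_sub _ _ _).trans (sub_eq_zero.2 this)
  obtain ⟨c, hc⟩ := exists_solution_of_finite_solvable Φ _ hΦ hfin
  refine ⟨fun x y h => c ⟨(x, y), h⟩, fun x y z h h' _ _ _ => ?_, fun x y h => ?_⟩
  · have := congrArg Prod.fst (hc ⟨(x, y, z), h, h'⟩)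
    have h₂ : c ⟨(x, z), h.trans h'⟩ - c ⟨(x, y), h⟩ ≫ N.map (homOfLE h') -
      M.map (homOfLE h) ≫ c ⟨(y, z), h'⟩ = 0 := this
    rwa [sub_sub, sub_eq_zero] at h₂
  -- The degenerate triple `(x, x, y)` carries the lifting condition for `x ≤ y`.
  · exact congrArg Prod.snd (hc ⟨(x, x, y), le_rfl, h⟩)

end DerivationLift

/-! ### The path category as a gluing of closed threads. -/

namespace ThreadQuiver

variable {V : Type u} [Quiver.{v} V] {T : ThreadQuiver.{u, v, w} V}

section Thread

variable (T) {a b : V} (α : a ⟶ b)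

/-- The thread of an arrow with the source adjoined as least and the target adjoined as greatest
element. -/
abbrev ClosedThread : Type w := WithBot (WithTop (T.thread α))

variable {T α}

/-- A point of a thread as an element of the closed thread. -/
abbrev ClosedThread.point (x : T.thread α) : T.ClosedThread α := ((x : WithTop _) : WithBot _)

lemma ClosedThread.point_le {x y : T.thread α} (h : x ≤ y) : point x ≤ point y :=
  WithBot.coe_le_coe.2 (WithTop.coe_le_coe.2 h)

/-- The objects of the path category on a closed thread. -/
def ClosedThread.toObj : T.ClosedThread α → T.Obj
  | none => .vertex a
  | some none => .vertex b
  | some (some x) => .point α x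

/-- The morphism `η_{y,x}` for `x ≤ y` in a closed thread. -/
def ClosedThread.η : ∀ {x y : T.ClosedThread α}, x ≤ y → (x.toObj ⟶ y.toObj)
  | none, none, _ => 𝟙 (Obj.vertex a)
  | none, some none, _ => PathLike.path α.toPath
  | none, some (some _), _ => PathLike.path (Quiver.Path.nil : Quiver.Path a a)
  | some _, none, h => (WithBot.not_coe_le_bot _ h).elim
  | some none, some none, _ => 𝟙 (Obj.vertex b)
  | some (some _), some none, _ => PathLike.path (Quiver.Path.nil : Quiver.Path b b)
  | some none, some (some _), h =>
    (WithTop.not_top_le_coe _ (WithBot.coe_le_coe.1 h)).elim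
  | some (some _), some (some _), h =>
    PathLike.along (WithTop.coe_le_coe.1 (WithBot.coe_le_coe.1 h))

lemma ClosedThread.η_refl (x : T.ClosedThread α) : η (le_refl x) = 𝟙 x.toObj := by
  obtain _ | _ | _ := x <;> rfl

lemma ClosedThread.η_comp {x y z : T.ClosedThread α} (h : x ≤ y) (h' : y ≤ z) :
    η h ≫ η h' = η (h.trans h') := by
  obtain _ | _ | x := x <;> obtain _ | _ | y := y <;> obtain _ | _ | z := z <;>
    first
    | rfl
    | exact (WithBot.not_coe_le_bot _ h).elim
    | exact (WithBot.not_coe_le_bot _ h').elim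
    | exact (WithTop.not_top_le_coe _ (WithBot.coe_le_coe.1 h)).elim
    | exact (WithTop.not_top_le_coe _ (WithBot.coe_le_coe.1 h')).elim

variable (T α) in
/-- The inclusion of a closed thread into the path category. -/
def threadFunctor : T.ClosedThread α ⥤ T.Obj where
  obj := ClosedThread.toObj
  map h := ClosedThread.η (leOfHom h)
  map_id x := ClosedThread.η_refl x
  map_comp f g := (ClosedThread.η_comp (leOfHom f) (leOfHom g)).symm

end Thread

/-- The morphisms of the path category are generated by the morphisms on the threads. -/
theorem hom_induction {P : ∀ ⦃x y : T.Obj⦄, (x ⟶ y) → Prop} (hid : ∀ x : T.Obj, P (𝟙 x))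
    (hcomp : ∀ ⦃x y z : T.Obj⦄ (f : x ⟶ y) (g : y ⟶ z), P f → P g → P (f ≫ g))
    (hη : ∀ ⦃a b : V⦄ (α : a ⟶ b) ⦃i j : T.ClosedThread α⦄ (h : i ≤ j), P (ClosedThread.η h))
    {x y : T.Obj} (f : x ⟶ y) : P f := by
  have hpath {a b : V} (p : Quiver.Path a b) :
      P (PathLike.path p : Obj.vertex (T := T) a ⟶ Obj.vertex b) := by
    induction p with
    | nil => exact hid (Obj.vertex a)
    | cons p α ih => exact hcomp _ _ ih (hη α (i := ⊥) (j := ⊤) bot_le)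
  have hout (x : T.Obj) : P (PathLike.path Quiver.Path.nil : x ⟶ Obj.vertex x.next) := by
    cases x with
    | vertex a => exact hid _
    | point α x => exact hη α (i := .point x) (j := ⊤) le_top
  have hinn (x : T.Obj) : P (PathLike.path Quiver.Path.nil : Obj.vertex x.prev ⟶ x) := by
    cases x with
    | vertex a => exact hid _
    | point α x => exact hη α (i := ⊥) (j := .point x) bot_le
  rcases f with h | p
  · exact hη _ (ClosedThread.point_le h)
  · let f₁ : x ⟶ Obj.vertex x.next := PathLike.path Quiver.Path.nil
    let f₂ : Obj.vertex (T := T) x.next ⟶ Obj.vertex y.prev := PathLike.path p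
    let f₃ : Obj.vertex y.prev ⟶ y := PathLike.path Quiver.Path.nil
    -- Leave the thread of `x`, follow the path between vertices, and enter the thread of `y`.
    have e : f₁ ≫ f₂ ≫ f₃ = PathLike.path p :=
      congrArg (PathLike.path (T := T) (x := x) (y := y)) (Quiver.Path.nil_comp p)
    exact e ▸ hcomp f₁ _ (hout x) (hcomp f₂ f₃ (hpath p) (hinn y))

lemma naturality_of_naturality_η {A : Type*} [Category A] {F G : T.Obj ⥤ A}
    (φ : ∀ x, F.obj x ⟶ G.obj x)
    (h : ∀ ⦃a b : V⦄ (α : a ⟶ b) ⦃i j : T.ClosedThread α⦄ (h : i ≤ j),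
      F.map (ClosedThread.η h) ≫ φ j.toObj = φ i.toObj ≫ G.map (ClosedThread.η h))
    {x y : T.Obj} (f : x ⟶ y) : F.map f ≫ φ y = φ x ≫ G.map f := by
  refine hom_induction (P := fun x y f => F.map f ≫ φ y = φ x ≫ G.map f) ?_ ?_ h f
  · simp
  · intro x y z f g hf hg
    rw [F.map_comp, G.map_comp, Category.assoc, hg, ← Category.assoc, hf, Category.assoc]

section Glue

variable {A : Type*} [Category A] (obj : T.Obj → A)
  (F : ∀ ⦃a b : V⦄ (α : a ⟶ b) ⦃i j : T.ClosedThread α⦄, i ≤ j → (obj i.toObj ⟶ obj j.toObj))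

/-- The value on an arrow of a functor glued from functors on the threads. -/
abbrev arrowPrefunctor : V ⥤q A where
  obj a := obj (.vertex a)
  map α := F α (i := ⊥) (j := ⊤) bot_le

/-- The value on `η_{t(α),x}` of a functor glued from functors on the threads. -/
def toNext : ∀ x : T.Obj, obj x ⟶ obj (.vertex x.next)
  | .vertex _ => 𝟙 _
  | .point α x => F α (i := .point x) (j := ⊤) le_top

/-- The value on `η_{x,s(α)}` of a functor glued from functors on the threads. -/
def fromPrev : ∀ x : T.Obj, obj (.vertex x.prev) ⟶ obj x
  | .vertex _ => 𝟙 _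
  | .point α x => F α (i := ⊥) (j := .point x) bot_le

/-- The value on a path-like element of a functor glued from functors on the threads. -/
def glueMap : ∀ {x y : T.Obj}, PathLike x y → (obj x ⟶ obj y)
  | _, _, .along (x := x) (y := y) h => F _ (i := .point x)
      (j := .point y) (ClosedThread.point_le h)
  | x, y, .path p => toNext obj F x ≫ composePath ((arrowPrefunctor obj F).mapPath p) ≫
      fromPrev obj F y

variable (hid : ∀ ⦃a b : V⦄ (α : a ⟶ b) (i : T.ClosedThread α), F α (le_refl i) = 𝟙 _)
  (hcomp : ∀ ⦃a b : V⦄ (α : a ⟶ b) ⦃i j l : T.ClosedThread α⦄ (h : i ≤ j) (h' : j ≤ l),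
    F α h ≫ F α h' = F α (h.trans h'))

-- The relation `η_{t(α),x} η_{x,s(α)} = α`, which makes `glue` respect composition of two paths
-- meeting at an interior point.
include hcomp in
lemma fromPrev_toNext (x : T.Obj) : fromPrev obj F x ≫ toNext obj F x =
    composePath ((arrowPrefunctor obj F).mapPath x.through) := by
  cases x with
  | vertex a => exact Category.comp_id _
  | point α x =>
    exact (hcomp α _ _).trans (Category.id_comp _).symm

/-- Functors on the closed threads that agree on the vertices glue to a functor on the path
category. -/
def glue : T.Obj ⥤ A where
  obj := obj
  map f := glueMap obj F f
  map_id x := by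
    cases x with
    | vertex a => exact (Category.id_comp _).trans (Category.id_comp _)
    | point α x => exact hid α _
  map_comp {x y z} f g := by
    rcases f with h | p
    · rcases g with h' | q
      · exact (hcomp _ _ _).symm
      · refine Eq.trans ?_ (Category.assoc _ _ _)
        exact congrArg (· ≫ _) (hcomp _ _ _).symm
    · rcases g with h' | q
      · refine Eq.trans ?_ (Category.assoc _ _ _).symm
        refine congrArg (_ ≫ ·) (Eq.trans ?_ (Category.assoc _ _ _).symm)
        exact congrArg (_ ≫ ·) (hcomp _ _ _).symm
      · change toNext obj F x ≫ composePath ((arrowPrefunctor obj F).mapPath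
          ((p.comp y.through).comp q)) ≫ fromPrev obj F z =
          (toNext obj F x ≫ composePath ((arrowPrefunctor obj F).mapPath p) ≫ fromPrev obj F y) ≫
          (toNext obj F y ≫ composePath ((arrowPrefunctor obj F).mapPath q) ≫ fromPrev obj F z)
        simp only [Prefunctor.mapPath_comp, composePath_comp, Category.assoc,
          ← fromPrev_toNext obj F hcomp]

lemma glue_map_η {a b : V} (α : a ⟶ b) {i j : T.ClosedThread α} (h : i ≤ j) :
    (glue obj F hid hcomp).map (ClosedThread.η h) = F α h := by
  obtain _ | _ | i := i <;> obtain _ | _ | j := j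
  · exact ((glue obj F hid hcomp).map_id (.vertex a)).trans (hid α ⊥).symm
  · exact (Category.id_comp _).trans ((Category.comp_id _).trans (Category.id_comp _))
  · exact (Category.id_comp _).trans (Category.id_comp _)
  · exact (WithBot.not_coe_le_bot _ h).elim
  · exact ((glue obj F hid hcomp).map_id (.vertex b)).trans (hid α ⊤).symm
  · exact (WithTop.not_top_le_coe _ (WithBot.coe_le_coe.1 h)).elim
  · exact (WithBot.not_coe_le_bot _ h).elim
  · exact (congrArg (_ ≫ ·) (Category.comp_id _)).trans (Category.comp_id _)
  · rfl

end Glue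

end ThreadQuiver

/-! ### Pointwise split extensions and their cocycles. -/

instance (k : Type t) [Field k] : SplitEpiCategory (FGModuleCat.{t} k) where
  isSplitEpi_of_epi f hf := by
    have h : Function.Surjective f.hom.hom := by
      have : Epi ((forget₂ (FGModuleCat.{t} k) (ModuleCat.{t} k)).map f) := inferInstance
      exact (ModuleCat.epi_iff_surjective _).1 this
    obtain ⟨s, hs⟩ := f.hom.hom.exists_rightInverse_of_surjective (LinearMap.range_eq_top.2 h)
    exact ⟨⟨⟨FGModuleCat.ofHom s, FGModuleCat.hom_ext hs⟩⟩⟩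

section PointwiseSplit

variable {A : Type*} [Category A] [Abelian A] {C : Type*} [Category C]

/-- A short exact sequence of functors that splits pointwise is described by a cocycle. -/
lemma CategoryTheory.ShortComplex.ShortExact.exists_cocycle [SplitEpiCategory A]
    {S : ShortComplex (C ⥤ A)} (hS : S.ShortExact) :
    ∃ (s : ∀ x, S.X₃.obj x ⟶ S.X₂.obj x) (c : ∀ ⦃x y⦄, (x ⟶ y) → (S.X₃.obj x ⟶ S.X₁.obj y)),
      (∀ x, s x ≫ S.g.app x = 𝟙 _) ∧
      (∀ ⦃x y⦄ (f : x ⟶ y), c f ≫ S.f.app y = s x ≫ S.X₂.map f - S.X₃.map f ≫ s y) ∧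
      ∀ ⦃x y z⦄ (f : x ⟶ y) (g : y ⟶ z),
        c (f ≫ g) = c f ≫ S.X₁.map g + S.X₃.map f ≫ c g := by
  have := hS.mono_f
  have := hS.epi_g
  have hx (x : C) : (S.map ((evaluation C A).obj x)).Exact := (hS.map_of_exact _).exact
  have hm (x : C) : Mono (S.map ((evaluation C A).obj x)).f := (hS.map_of_exact _).mono_f
  have he (x : C) : IsSplitEpi (S.g.app x) := isSplitEpi_of_epi _
  let s (x : C) := section_ (S.g.app x)
  have hs (x : C) : s x ≫ S.g.app x = 𝟙 _ := IsSplitEpi.id _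
  have h0 ⦃x y : C⦄ (f : x ⟶ y) : (s x ≫ S.X₂.map f - S.X₃.map f ≫ s y) ≫ S.g.app y = 0 := by
    rw [Preadditive.sub_comp, Category.assoc, Category.assoc, hs, S.g.naturality,
      ← Category.assoc, hs, Category.id_comp, Category.comp_id, sub_self]
  -- The failure of the sections to be natural is killed by `S.g`, so it factors through `S.f`.
  let c ⦃x y : C⦄ (f : x ⟶ y) : S.X₃.obj x ⟶ S.X₁.obj y := (hx y).lift _ (h0 f)
  have hc ⦃x y : C⦄ (f : x ⟶ y) : c f ≫ S.f.app y = s x ≫ S.X₂.map f - S.X₃.map f ≫ s y :=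
    (hx y).lift_f _ (h0 f)
  refine ⟨s, c, hs, hc, fun x y z f g => ?_⟩
  rw [← cancel_mono (S.f.app z), Preadditive.add_comp, Category.assoc, Category.assoc,
    S.f.naturality, hc, hc, ← Category.assoc (c f), hc]
  simp [Preadditive.comp_sub, Preadditive.sub_comp]

/-- A sequence of functors that is pointwise the standard split one is short exact. -/
lemma shortExact_of_app_eq {N E M : C ⥤ A} (j : N ⟶ E) (r : E ⟶ M) (w : j ≫ r = 0)
    (h : ∀ x, ∃ (a : E.obj x ⟶ N.obj x) (b : M.obj x ⟶ E.obj x), j.app x ≫ a = 𝟙 _ ∧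
      b ≫ r.app x = 𝟙 _ ∧ a ≫ j.app x + r.app x ≫ b = 𝟙 _) :
    (ShortComplex.mk j r w).ShortExact := by
  choose a b h₁ h₂ h₃ using h
  have (x : C) : Mono (j.app x) := ⟨fun f g h => by
    rw [← Category.comp_id f, ← Category.comp_id g, ← h₁, reassoc_of% h]⟩
  have (x : C) : Epi (r.app x) := ⟨fun f g h => by
    rw [← Category.id_comp f, ← Category.id_comp g, ← h₂, Category.assoc, Category.assoc, h]⟩
  have := NatTrans.mono_of_mono_app j
  have := NatTrans.epi_of_epi_app r
  refine { exact := ShortComplex.exact_of_f_is_kernel _ (KernelFork.IsLimit.ofι' _ _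
    fun {W} t ht => ?_) }
  have hta (x : C) : (t.app x ≫ a x) ≫ j.app x = t.app x := by
    have h0 : t.app x ≫ r.app x = 0 := congrArg (fun f => f.app x) ht
    have := congrArg (t.app x ≫ ·) (h₃ x)
    simpa [Preadditive.comp_add, reassoc_of% h0] using this
  refine ⟨⟨fun x => t.app x ≫ a x, fun x y f => ?_⟩, NatTrans.ext (funext hta)⟩
  rw [← cancel_mono (j.app y), Category.assoc, hta, Category.assoc, j.naturality,
    ← Category.assoc, hta, t.naturality]

end PointwiseSplit

section Triangular

variable {A : Type*} [Category A] [Preadditive A] [HasBinaryBiproducts A]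

/-- The morphism given by an upper triangular matrix. -/
noncomputable def triangular {N M N' M' : A} (n : N ⟶ N') (c : M ⟶ N') (m : M ⟶ M') :
    N ⊞ M ⟶ N' ⊞ M' :=
  biprod.desc (n ≫ biprod.inl) (c ≫ biprod.inl + m ≫ biprod.inr)

lemma triangular_id {N M : A} : triangular (𝟙 N) 0 (𝟙 M) = 𝟙 _ := by
  ext <;> simp [triangular]

lemma triangular_comp {N M N' M' N'' M'' : A} (n : N ⟶ N') (c : M ⟶ N') (m : M ⟶ M')
    (n' : N' ⟶ N'') (c' : M' ⟶ N'') (m' : M' ⟶ M'') :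
    triangular n c m ≫ triangular n' c' m' =
      triangular (n ≫ n') (c ≫ n' + m ≫ c') (m ≫ m') := by
  ext <;> simp [triangular]

end Triangular

/-! ### Lifting extensions of representations. -/

namespace ThreadQuiver

variable {V : Type u} [Quiver.{v} V] {T : ThreadQuiver.{u, v, w} V}

/-- The lifted extension is `N ⊞ M` pointwise, with a lifted cocycle as off-diagonal entry. The
objects do not depend on the cocycle, so lifts chosen independently on the threads agree at the
vertices and glue. -/
theorem liftsExtensions_functor {A : Type*} [Category A] [Abelian A] [SplitEpiCategory A]
    (k : Type t) [Field k] [Linear k A] [∀ X Y : A, FiniteDimensional k (X ⟶ Y)] :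
    LiftsExtensions (T.Obj ⥤ A) := by
  intro S hS N p hp
  obtain ⟨s, c', hs, hc', hc'd⟩ := hS.exists_cocycle
  have hsp (x : T.Obj) : IsSplitEpi (p.app x) := isSplitEpi_of_epi _
  have hlift {a b : V} (α : a ⟶ b) :
      ∃ c : ∀ ⦃i j : T.ClosedThread α⦄, i ≤ j → (S.X₃.obj i.toObj ⟶ N.obj j.toObj),
        (∀ ⦃i j l : T.ClosedThread α⦄ (h : i ≤ j) (h' : j ≤ l), c (h.trans h') =
          c h ≫ N.map (ClosedThread.η h') + S.X₃.map (ClosedThread.η h) ≫ c h') ∧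
        ∀ ⦃i j : T.ClosedThread α⦄ (h : i ≤ j), c h ≫ p.app j.toObj = c' (ClosedThread.η h) := by
    let J := T.threadFunctor α
    have hi (i : T.ClosedThread α) : IsSplitEpi ((Functor.whiskerLeft J p).app i) := hsp _
    have hd : IsDerivationOn (M := J ⋙ S.X₃) (N := J ⋙ S.X₁) Set.univ
        fun i j h => c' (ClosedThread.η h) := fun i j l h h' _ _ _ =>
      (congrArg (fun f => c' f) (ClosedThread.η_comp h h').symm).trans (hc'd _ _)
    obtain ⟨c, hc, hcp⟩ := hd.exists_lift (Functor.whiskerLeft J p) k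
    exact ⟨c, fun i j l h h' => hc h h' trivial trivial trivial, hcp⟩
  choose c hc hcp using @hlift
  have hc₀ {a b : V} (α : a ⟶ b) (i : T.ClosedThread α) : c α (le_refl i) = 0 := by
    have := hc α (le_refl i) (le_refl i)
    rw [ClosedThread.η_refl, N.map_id, S.X₃.map_id, Category.comp_id, Category.id_comp] at this
    simpa using this
  let F ⦃a b : V⦄ (α : a ⟶ b) ⦃i j : T.ClosedThread α⦄ (h : i ≤ j) :
      N.obj i.toObj ⊞ S.X₃.obj i.toObj ⟶ N.obj j.toObj ⊞ S.X₃.obj j.toObj :=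
    triangular (N.map (ClosedThread.η h)) (c α h) (S.X₃.map (ClosedThread.η h))
  have hF₁ ⦃a b : V⦄ (α : a ⟶ b) (i : T.ClosedThread α) : F α (le_refl i) = 𝟙 _ := by
    dsimp only [F]
    rw [hc₀, ClosedThread.η_refl, N.map_id, S.X₃.map_id, triangular_id]
  have hF₂ ⦃a b : V⦄ (α : a ⟶ b) ⦃i j l : T.ClosedThread α⦄ (h : i ≤ j) (h' : j ≤ l) :
      -- The off-diagonal entry of this identity is the Leibniz rule.
      F α h ≫ F α h' = F α (h.trans h') := by
    simp only [F, triangular_comp, ← Functor.map_comp, ClosedThread.η_comp, ← hc]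
  let E := glue (fun x => N.obj x ⊞ S.X₃.obj x) F hF₁ hF₂
  have hE ⦃a b : V⦄ (α : a ⟶ b) ⦃i j : T.ClosedThread α⦄ (h : i ≤ j) :
      E.map (ClosedThread.η h) = F α h := glue_map_η (fun x => N.obj x ⊞ S.X₃.obj x) F hF₁ hF₂ α h
  let j : N ⟶ E :=
    { app x := (biprod.inl : N.obj x ⟶ N.obj x ⊞ S.X₃.obj x)
      naturality _ _ f := naturality_of_naturality_η (F := N) (G := E) (fun x => biprod.inl)
        (fun a b α i j h => by rw [hE]; exact (biprod.inl_desc _ _).symm) f }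
  -- On the summand `M` the map is the pointwise section `s`. Naturality there says that the cocycle
  -- of `E`, pushed along `p`, is the cocycle of `S`.
  let q : E ⟶ S.X₂ :=
    { app x := biprod.desc (p.app x ≫ S.f.app x) (s x)
      naturality _ _ f := naturality_of_naturality_η (F := E) (G := S.X₂)
        (fun x => biprod.desc (p.app x ≫ S.f.app x) (s x))
        (fun a b α i j h => by
          rw [hE]
          change F α h ≫ biprod.desc (p.app _ ≫ S.f.app _) (s _) =
            biprod.desc (p.app _ ≫ S.f.app _) (s _) ≫ S.X₂.map _
          ext
          · simp [F, triangular]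
          · simp [F, triangular, reassoc_of% hcp, hc']) f }
  have hr (x : T.Obj) : (q ≫ S.g).app x = (biprod.snd : N.obj x ⊞ S.X₃.obj x ⟶ S.X₃.obj x) := by
    have h0 : S.f.app x ≫ S.g.app x = 0 := congrArg (fun f => f.app x) S.zero
    change biprod.desc (p.app x ≫ S.f.app x) (s x) ≫ S.g.app x = _
    ext <;> simp [h0, hs]
  refine ⟨E, j, q, NatTrans.ext (funext fun x => ?_), shortExact_of_app_eq _ _ _ fun x =>
    ⟨(biprod.fst : N.obj x ⊞ S.X₃.obj x ⟶ _), (biprod.inr : _ ⟶ N.obj x ⊞ S.X₃.obj x),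
      biprod.inl_fst, ?_, ?_⟩, NatTrans.ext (funext fun x => biprod.inl_desc _ _)⟩
  · exact (congrArg (_ ≫ ·) (hr x)).trans biprod.inl_snd
  · exact (congrArg (_ ≫ ·) (hr x)).trans biprod.inr_snd
  · rw [hr]
    exact biprod.total

end ThreadQuiver

theorem CategoryTheory.LiftsExtensions.of_equivalence {A B : Type*} [Category A] [Abelian A]
    [Category B] [Abelian B] (F : A ⥤ B) [F.IsEquivalence] [F.Additive] (h : LiftsExtensions B) :
    LiftsExtensions A := by
  intro S hS N p hp
  obtain ⟨E, j, q, w, hE, hq⟩ : ∃ (E : B) (j : F.obj N ⟶ E) (q : E ⟶ F.obj S.X₂)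
      (w : j ≫ q ≫ F.map S.g = 0), (ShortComplex.mk j (q ≫ F.map S.g) w).ShortExact ∧
        j ≫ q = F.map p ≫ F.map S.f :=
    h (S.map F) (hS.map_of_exact F) (F.obj N) (F.map p) (F.map_epi p)
  let e := F.objObjPreimageIso E
  let j' := F.preimage (j ≫ e.inv)
  let q' := F.preimage (e.hom ≫ q)
  have hj : F.map j' = j ≫ e.inv := F.map_preimage _
  have hq' : F.map q' = e.hom ≫ q := F.map_preimage _
  have w' : j' ≫ q' ≫ S.g = 0 := F.map_injective (by simpa [hj, hq'] using w)
  refine ⟨F.objPreimage E, j', q', w', ?_, F.map_injective (by simpa [hj, hq'] using hq)⟩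
  let T := ShortComplex.mk j' (q' ≫ S.g) w'
  have hg : e.inv ≫ F.map (q' ≫ S.g) = q ≫ F.map S.g := by simp [hq']
  have hT : (T.map F).ShortExact := ShortComplex.shortExact_of_iso
    (ShortComplex.isoMk (S₂ := T.map F) (Iso.refl (F.obj N)) e.symm (Iso.refl (F.obj S.X₃))
      ((Category.id_comp _).trans hj) (hg.trans (Category.comp_id _).symm)) hE
  exact { exact := (T.exact_map_iff_of_faithful F).1 hT.exact
          mono_f := F.mono_of_mono_map hT.mono_f
          epi_g := F.epi_of_epi_map hT.epi_g }

open ThreadQuiver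

theorem mainTheorem8 {V : Type u} [Quiver.{v} V] (T : ThreadQuiver.{u, v, w} V)
    (k : Type t) [Field k] (hT : T.IsLeftQBounded k ∨ T.IsRightQBounded k) :
    IsHereditary (T.RepPwf k) ∧
      ∀ (L P : T.RepPwf k) (i : L ⟶ P), Mono i → Projective P → Projective L := by
  have h : LiftsExtensions (T.RepPwf k) := .of_equivalence (T.restrict k) (liftsExtensions_functor k)
  exact ⟨h.isHereditary, fun L P i _ _ => h.projective_of_mono i⟩
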